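/- **Theorem 2.2 (existence of the dynamics).** Let $(\Lambda,d)$ be a metric space whose points are called sites, and let a non-zero finite-dimensional complex Hilbert space $\mathcal H_x$ be given for every $x\in\Lambda$. For finite $X\subset\Lambda$ put $\mathcal H_X=\bigotimes_{x\in X}\mathcal H_x$ and $\mathcal A_X=\mathcal B(\mathcal H_X)$; for $X\subset Y$ regard $\mathcal A_X$ as a subalgebra of $\mathcal A_Y$ through $T\mapsto T\otimes 1$. Let the quasi-local algebra $\mathcal A$ be the $C^*$-algebra obtained as the norm completion of $\bigcup_X\mathcal A_X$, the union being over the finite subsets of $\Lambda$. Let $F:[0,\infty)\to(0,\infty)$ be a non-increasing function with $$\sup_{x\in\Lambda}\sum_{y\in\Lambda}F(d(x,y))<\infty,\qquad \sup_{x,y\in\Lambda}\sum_{z\in\Lambda}\frac{F(d(x,z))\,F(d(z,y))}{F(d(x,y))}<\infty ,$$ and for $a\ge 0$ put $F_a(r)=e^{-ar}F(r)$. An interaction $\Phi$ assigns to every finite $X\subset\Lambda$ an element $\Phi(X)=\Phi(X)^*\in\mathcal A_X$, and $\mathcal B_a(\Lambda)$ is the set of the interactions with $$\|\Phi\|_a=\sup_{x,y\in\Lambda}\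 \sum_{X\ni x,y}\frac{\|\Phi(X)\|}{F_a(d(x,y))}<\infty .$$ For finite $V\subset\Lambda$ let $H_V=\sum_{X\subset V}\Phi(X)$ and $\tau^V_t(A)=e^{itH_V}Ae^{-itH_V}$ for $A\in\mathcal A$ and $t\in\mathbb R$. Let $a\ge 0$ and $\Phi\in\mathcal B_a(\Lambda)$. Then there is exactly one strongly continuous one-parameter group $(\tau_t)_{t\in\mathbb R}$ of $*$-automorphisms of $\mathcal A$ such that, for every increasing sequence $(\Lambda_n)$ of finite subsets of $\Lambda$ with union $\Lambda$ and every $A\in\mathcal A$, $$\lim_{n\to\infty}\big\|\tau_t^{\Lambda_n}(A)-\tau_t(A)\big\|=0,$$ uniformly for $t$ in compact subsets of $\mathbb R$. In particular, the limit does not depend on the choice of the sequence $(\Lambda_n)$. -/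

import Mathlib

open scoped TensorProduct InnerProductSpace ComplexConjugate

noncomputable section

namespace QuantumSpin

section HilbertTensor

universe u v
variable {ι : Type u} (E : ι → Type v) [∀ i, NormedAddCommGroup (E i)]
  [∀ i, InnerProductSpace ℂ (E i)] 

/-- The underlying vector space of the tensor product of a finite family of finite-dimensional
complex Hilbert spaces. It is a type of its own because `PiTensorProduct` carries the projective
seminorm in Mathlib, whereas the Hilbert space norm is needed here. -/
def HilbertTensor : Type (max u v) := PiTensorProduct ℂ E

instance : AddCommGroup (HilbertTensor E) := inferInstanceAs (AddCommGroup (PiTensorProduct ℂ E))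

instance : Module ℂ (HilbertTensor E) := inferInstanceAs (Module ℂ (PiTensorProduct ℂ E))

variable {E}

/-- The elementary tensor of the family `v`. -/
def HilbertTensor.tprod (v : ∀ i, E i) : HilbertTensor E := PiTensorProduct.tprod ℂ v

theorem HilbertTensor.linearMap_ext {F : Type*} [AddCommGroup F] [Module ℂ F]
    {f g : HilbertTensor E →ₗ[ℂ] F} (h : ∀ v, f (.tprod v) = g (.tprod v)) : f = g :=
  PiTensorProduct.ext (MultilinearMap.ext h)

theorem HilbertTensor.span_tprod :
    Submodule.span ℂ (Set.range (HilbertTensor.tprod (E := E))) = ⊤ :=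
  PiTensorProduct.span_tprod_eq_top

variable [∀ i, FiniteDimensional ℂ (E i)] [Finite ι]

variable (E) in
/-- The product basis of orthonormal bases of the factors. -/
def HilbertTensor.basis :
    Module.Basis (∀ i, Fin (Module.finrank ℂ (E i))) ℂ (HilbertTensor E) :=
  Basis.piTensorProduct fun i => (stdOrthonormalBasis ℂ (E i)).toBasis

instance : FiniteDimensional ℂ (HilbertTensor E) :=
  (HilbertTensor.basis E).finiteDimensional_of_finite

variable (E) in
/-- The inner product making the product basis orthonormal. It is the usual inner product of the
tensor product, i.e. the one with `⟪⊗ v i, ⊗ w i⟫ = ∏ i, ⟪v i, w i⟫`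
(`HilbertTensor.inner_tprod`), and so does not depend on the bases. -/
abbrev HilbertTensor.core : InnerProductSpace.Core ℂ (HilbertTensor E) where
  inner x y :=
    letI := Fintype.ofFinite (∀ i, Fin (Module.finrank ℂ (E i)))
    ∑ p, conj ((HilbertTensor.basis E).repr x p) * (HilbertTensor.basis E).repr y p
  conj_inner_symm x y := by simp [mul_comm]
  re_inner_nonneg x := by
    simp only [← Complex.normSq_eq_conj_mul_self]
    simp only [map_sum]
    exact Finset.sum_nonneg fun p _ => by simp [Complex.normSq_nonneg]
  add_left x y z := by simp [add_mul, Finset.sum_add_distrib]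
  smul_left x y r := by simp [Finset.mul_sum, mul_assoc]
  definite x hx := by
    let _ := Fintype.ofFinite (∀ i, Fin (Module.finrank ℂ (E i)))
    simp only [← Complex.normSq_eq_conj_mul_self] at hx
    norm_cast at hx
    rw [Finset.sum_eq_zero_iff_of_nonneg fun p _ => Complex.normSq_nonneg _] at hx
    refine (HilbertTensor.basis E).ext_elem fun p => ?_
    simpa using hx p (Finset.mem_univ p)

instance : NormedAddCommGroup (HilbertTensor E) := (HilbertTensor.core E).toNormedAddCommGroup

instance : InnerProductSpace ℂ (HilbertTensor E) := InnerProductSpace.ofCore _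

instance : CompleteSpace (HilbertTensor E) := FiniteDimensional.complete ℂ _

theorem HilbertTensor.basis_repr_tprod [Fintype ι] (v : ∀ i, E i)
    (p : ∀ i, Fin (Module.finrank ℂ (E i))) :
    (HilbertTensor.basis E).repr (.tprod v) p =
      ∏ i, (stdOrthonormalBasis ℂ (E i)).toBasis.repr (v i) (p i) :=
  Basis.piTensorProduct_repr_tprod_apply _ _ _

theorem HilbertTensor.inner_def (x y : HilbertTensor E) : ⟪x, y⟫_ℂ =
    letI := Fintype.ofFinite (∀ i, Fin (Module.finrank ℂ (E i)))
    ∑ p, conj ((HilbertTensor.basis E).repr x p) * (HilbertTensor.basis E).repr y p := rfl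

theorem HilbertTensor.inner_tprod [Fintype ι] (v w : ∀ i, E i) :
    ⟪HilbertTensor.tprod v, HilbertTensor.tprod w⟫_ℂ = ∏ i, ⟪v i, w i⟫_ℂ := by
  classical
  have h : ∀ i, ⟪v i, w i⟫_ℂ = ∑ j, conj ((stdOrthonormalBasis ℂ (E i)).toBasis.repr (v i) j) *
      (stdOrthonormalBasis ℂ (E i)).toBasis.repr (w i) j := by
    intro i
    rw [← (stdOrthonormalBasis ℂ (E i)).sum_inner_mul_inner]
    simp [OrthonormalBasis.repr_apply_apply]
  simp_rw [h, Finset.prod_univ_sum]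
  rw [HilbertTensor.inner_def]
  rw [Subsingleton.elim (Fintype.ofFinite (∀ i, Fin (Module.finrank ℂ (E i)))) Pi.instFintype]
  rw [Fintype.piFinset_univ]
  refine Finset.sum_congr rfl fun p _ => ?_
  rw [HilbertTensor.basis_repr_tprod, HilbertTensor.basis_repr_tprod, map_prod,
    Finset.prod_mul_distrib]

theorem HilbertTensor.inner_ext {F : Type*} [NormedAddCommGroup F] [InnerProductSpace ℂ F]
    {f g : HilbertTensor E →ₗ[ℂ] F} (h : ∀ v w, ⟪f (.tprod v), g (.tprod w)⟫_ℂ =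
      ⟪HilbertTensor.tprod v, HilbertTensor.tprod w⟫_ℂ) (x y : HilbertTensor E) :
    ⟪f x, g y⟫_ℂ = ⟪x, y⟫_ℂ := by
  have hx : x ∈ Submodule.span ℂ (Set.range (HilbertTensor.tprod (E := E))) := by
    rw [HilbertTensor.span_tprod]; trivial
  have hy : y ∈ Submodule.span ℂ (Set.range (HilbertTensor.tprod (E := E))) := by
    rw [HilbertTensor.span_tprod]; trivial
  induction hx, hy using Submodule.span_induction₂ with
  | mem_mem x y hx hy => obtain ⟨v, rfl⟩ := hx; obtain ⟨w, rfl⟩ := hy; exact h v w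
  | zero_left => simp
  | zero_right => simp
  | add_left x y z _ _ _ h₁ h₂ => simp [h₁, h₂]
  | add_right x y z _ _ _ h₁ h₂ => simp [h₁, h₂]
  | smul_left r x y _ _ h => simp [h]
  | smul_right r x y _ _ h => simp [h]

instance [∀ i, Nontrivial (E i)] : Nontrivial (HilbertTensor E) := by
  have := Fintype.ofFinite ι
  choose v hv using fun i => exists_ne (0 : E i)
  refine ⟨⟨.tprod v, 0, fun h => ?_⟩⟩
  have := HilbertTensor.inner_tprod v v
  rw [h, inner_zero_left, eq_comm, Finset.prod_eq_zero_iff] at this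
  obtain ⟨i, -, hi⟩ := this
  exact hv i (inner_self_eq_zero.mp hi)

end HilbertTensor


section Ampliation

theorem star_rTensor {E F : Type*} [NormedAddCommGroup E] [InnerProductSpace ℂ E]
    [FiniteDimensional ℂ E] [NormedAddCommGroup F] [InnerProductSpace ℂ F]
    [FiniteDimensional ℂ F] [CompleteSpace E] [CompleteSpace (E ⊗[ℂ] F)] (T : E →L[ℂ] E) :
    star (T.rTensor F) = (star T).rTensor F := by
  rw [ContinuousLinearMap.star_eq_adjoint, eq_comm, ContinuousLinearMap.eq_adjoint_iff]
  intro x y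
  induction x with
  | zero => simp
  | add x x' h h' => rw [map_add, inner_add_left, inner_add_left, h, h']
  | tmul a b =>
    induction y with
    | zero => simp
    | add y y' h h' => rw [map_add, inner_add_right, inner_add_right, h, h']
    | tmul c d =>
      simp [TensorProduct.inner_tmul,
        ContinuousLinearMap.star_eq_adjoint, ContinuousLinearMap.adjoint_inner_left]

instance {E F : Type*} [NormedAddCommGroup E] [InnerProductSpace ℂ E]
    [FiniteDimensional ℂ E] [NormedAddCommGroup F] [InnerProductSpace ℂ F]
    [FiniteDimensional ℂ F] : CompleteSpace (E ⊗[ℂ] F) := FiniteDimensional.complete ℂ _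


variable {E F G : Type*} [NormedAddCommGroup E] [InnerProductSpace ℂ E]
  [FiniteDimensional ℂ E] [NormedAddCommGroup F] [InnerProductSpace ℂ F]
  [FiniteDimensional ℂ F] [NormedAddCommGroup G] [InnerProductSpace ℂ G]
  [CompleteSpace E] [CompleteSpace G]

variable (F) in
/-- The map `T ↦ T ⊗ 1` as a unital `*`-homomorphism. -/
def rTensorStarHom : (E →L[ℂ] E) →⋆ₐ[ℂ] (E ⊗[ℂ] F →L[ℂ] E ⊗[ℂ] F) where
  toFun T := T.rTensor F
  map_one' := ContinuousLinearMap.rTensor_one _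
  map_mul' := ContinuousLinearMap.rTensor_mul _
  map_zero' := ContinuousLinearMap.rTensor_zero _
  map_add' := ContinuousLinearMap.rTensor_add _
  commutes' c := by
    rw [Algebra.algebraMap_eq_smul_one, ContinuousLinearMap.rTensor_smul,
      ContinuousLinearMap.rTensor_one, Algebra.algebraMap_eq_smul_one]
  map_star' T := (star_rTensor T).symm

/-- The map `T ↦ T ⊗ 1`, transported along an identification of `E ⊗ F` with `G`. -/
def ampliation (e : E ⊗[ℂ] F ≃ₗᵢ[ℂ] G) : (E →L[ℂ] E) →⋆ₐ[ℂ] (G →L[ℂ] G) :=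
  e.conjStarAlgEquiv.toStarAlgHom.comp (rTensorStarHom F)

theorem ampliation_apply (e : E ⊗[ℂ] F ≃ₗᵢ[ℂ] G) (T : E →L[ℂ] E) (x : G) :
    ampliation e T x = e (T.rTensor F (e.symm x)) := rfl

theorem ampliation_tmul (e : E ⊗[ℂ] F ≃ₗᵢ[ℂ] G) (T : E →L[ℂ] E) (x : E) (y : F) :
    ampliation e T (e (x ⊗ₜ y)) = e (T x ⊗ₜ y) := by
  rw [ampliation_apply, e.symm_apply_apply, ContinuousLinearMap.rTensor_tmul]

theorem ampliation_injective [Nontrivial F] (e : E ⊗[ℂ] F ≃ₗᵢ[ℂ] G) :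
    Function.Injective (ampliation e) := by
  rw [injective_iff_map_eq_zero]
  intro T hT
  obtain ⟨y, hy⟩ := exists_ne (0 : F)
  ext x
  have h := ampliation_tmul e T x y
  rw [hT, zero_apply, eq_comm, map_eq_zero_iff e e.injective,
    ← norm_eq_zero, TensorProduct.norm_tmul, mul_eq_zero] at h
  simpa [hy] using h

end Ampliation

section LocalAlgebras

universe u v
variable {Λ : Type u}

open Classical in
/-- The family `v` with its components in `X` replaced by those of `u`. -/
def glue {H : Λ → Type v} {X Y : Finset Λ} (u : ∀ x : X, H x) (v : ∀ y : Y, H y) : ∀ y : Y, H y :=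
  fun y => if hy : (y : Λ) ∈ X then u ⟨y, hy⟩ else v y

theorem glue_glue {H : Λ → Type v} {X Y Z : Finset Λ} (hXY : X ⊆ Y) (hYZ : Y ⊆ Z) (u : ∀ x : X, H x)
    (v : ∀ z : Z, H z) : glue (glue u fun y : Y => v ⟨y, hYZ y.2⟩) v = glue u v := by
  funext z
  by_cases h₁ : (z : Λ) ∈ X
  · simp [glue, h₁, hXY h₁]
  · simp [glue, h₁]

variable (H : Λ → Type v) [∀ x, NormedAddCommGroup (H x)]
  [∀ x, InnerProductSpace ℂ (H x)]

/-- The Hilbert space of the finite set `X` of sites: the tensor product of the `H x`, `x ∈ X`. -/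
abbrev LocalSpace (X : Finset Λ) : Type (max u v) := HilbertTensor fun x : X => H x

/-- The Hilbert space of the sites in `Y \ X`. -/
abbrev OuterSpace (X Y : Finset Λ) : Type (max u v) :=
  HilbertTensor fun y : {y : Y // (y : Λ) ∉ X} => H y

/-- A finite set `Y ⊇ X` is the disjoint union of `X` and `Y \ X`. -/
def splitSites {X Y : Finset Λ} (h : X ⊆ Y) : X ⊕ {y : Y // (y : Λ) ∉ X} ≃ Y where
  toFun := Sum.elim (fun x => ⟨x, h x.2⟩) Subtype.val
  invFun y := open Classical in if hy : (y : Λ) ∈ X then .inl ⟨y, hy⟩ else .inr ⟨y, hy⟩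
  left_inv z := by
    rcases z with x | y
    · simp
    · simp [y.2]
  right_inv y := by
    by_cases hy : (y : Λ) ∈ X <;> simp [hy]

/-- The canonical isomorphism of the Hilbert spaces of `X` and `Y \ X`, tensored, with that of `Y`
(on elementary tensors: `splitLinear_symm_tprod`). -/
def splitLinear {X Y : Finset Λ} (h : X ⊆ Y) :
    LocalSpace H X ⊗[ℂ] OuterSpace H X Y ≃ₗ[ℂ] LocalSpace H Y :=
  (PiTensorProduct.tmulEquivDep ℂ fun i => H (splitSites h i)).trans
    (PiTensorProduct.reindex ℂ (fun y : Y => H y) (splitSites h).symm).symm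

theorem splitLinear_symm_tprod {X Y : Finset Λ} (h : X ⊆ Y) (v : ∀ y : Y, H y) :
    (splitLinear H h).symm (.tprod v) =
      HilbertTensor.tprod (fun x : X => v ⟨x, h x.2⟩) ⊗ₜ[ℂ]
        HilbertTensor.tprod (fun y : {y : Y // (y : Λ) ∉ X} => v y) := by
  change (PiTensorProduct.tmulEquivDep ℂ fun i => H (splitSites h i)).symm
    (PiTensorProduct.reindex ℂ (fun y : Y => H y) (splitSites h).symm
      (PiTensorProduct.tprod ℂ v)) = _
  rw [PiTensorProduct.reindex_tprod]
  exact PiTensorProduct.tmulEquivDep_symm_apply _ _ _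

variable [∀ x, FiniteDimensional ℂ (H x)]

/-- The observables supported in `X`: the bounded operators on the Hilbert space of `X`, with the
operator norm and the adjoint. -/
abbrev LocalAlgebra (X : Finset Λ) : Type (max u v) := LocalSpace H X →L[ℂ] LocalSpace H X

instance (X : Finset Λ) : CStarAlgebra (LocalAlgebra H X) := inferInstance

/-- The canonical isomorphism `splitLinear` is unitary. -/
def splitIsometry {X Y : Finset Λ} (h : X ⊆ Y) :
    LocalSpace H X ⊗[ℂ] OuterSpace H X Y ≃ₗᵢ[ℂ] LocalSpace H Y :=
  ((splitLinear H h).symm.isometryOfInner fun x y =>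
    have := Fintype.ofFinite {y : Y // (y : Λ) ∉ X}
    HilbertTensor.inner_ext (f := (splitLinear H h).symm.toLinearMap)
      (g := (splitLinear H h).symm.toLinearMap) (fun v w => by
        simp only [LinearEquiv.coe_coe]
        rw [splitLinear_symm_tprod, splitLinear_symm_tprod, TensorProduct.inner_tmul,
          HilbertTensor.inner_tprod, HilbertTensor.inner_tprod, HilbertTensor.inner_tprod,
          ← (splitSites h).prod_comp, Fintype.prod_sum_type]
        rfl) x y).symm

theorem splitIsometry_symm_tprod {X Y : Finset Λ} (h : X ⊆ Y) (v : ∀ y : Y, H y) :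
    (splitIsometry H h).symm (.tprod v) =
      HilbertTensor.tprod (fun x : X => v ⟨x, h x.2⟩) ⊗ₜ[ℂ]
        HilbertTensor.tprod (fun y : {y : Y // (y : Λ) ∉ X} => v y) :=
  splitLinear_symm_tprod H h v

/-- The natural embedding `T ↦ T ⊗ 1` of the observables in `X` into those in `Y ⊇ X`. -/
def localEmbedding {X Y : Finset Λ} (h : X ⊆ Y) : LocalAlgebra H X →⋆ₐ[ℂ] LocalAlgebra H Y :=
  ampliation (splitIsometry H h)

theorem localEmbedding_injective [∀ x, Nontrivial (H x)] {X Y : Finset Λ} (h : X ⊆ Y) :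
    Function.Injective (localEmbedding H h) := ampliation_injective _

theorem splitIsometry_tprod_tmul {X Y : Finset Λ} (h : X ⊆ Y) (v : ∀ y : Y, H y) :
    splitIsometry H h (HilbertTensor.tprod (fun x : X => v ⟨x, h x.2⟩) ⊗ₜ[ℂ]
        HilbertTensor.tprod (fun y : {y : Y // (y : Λ) ∉ X} => v y)) = .tprod v := by
  rw [← splitIsometry_symm_tprod, LinearIsometryEquiv.apply_symm_apply]

/-- The linear map with `⊗ u x ↦ ⊗ (glue u v) y`. -/
def glueMap {X Y : Finset Λ} (h : X ⊆ Y) (v : ∀ y : Y, H y) :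
    LocalSpace H X →ₗ[ℂ] LocalSpace H Y :=
  (splitIsometry H h).toLinearEquiv.toLinearMap ∘ₗ (TensorProduct.mk ℂ _ _).flip
    (HilbertTensor.tprod (fun y : {y : Y // (y : Λ) ∉ X} => v y))

theorem glueMap_tprod {X Y : Finset Λ} (h : X ⊆ Y) (v : ∀ y : Y, H y) (u : ∀ x : X, H x) :
    glueMap H h v (.tprod u) = .tprod (glue u v) := by
  rw [← splitIsometry_tprod_tmul H h]
  have h₁ : (fun x : X => glue u v ⟨x, h x.2⟩) = u := by funext x; simp [glue]
  have h₂ : (fun y : {y : Y // (y : Λ) ∉ X} => glue u v y) =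
      fun y : {y : Y // (y : Λ) ∉ X} => v y := by
    funext y; simp [glue, y.2]
  rw [h₁, h₂]
  rfl

theorem localEmbedding_tprod {X Y : Finset Λ} (h : X ⊆ Y) (T : LocalAlgebra H X)
    (v : ∀ y : Y, H y) : localEmbedding H h T (.tprod v) =
      glueMap H h v (T (.tprod fun x : X => v ⟨x, h x.2⟩)) := by
  rw [← splitIsometry_tprod_tmul H h]
  exact ampliation_tmul _ _ _ _

theorem glueMap_glueMap {X Y Z : Finset Λ} (hXY : X ⊆ Y) (hYZ : Y ⊆ Z)
    (v : ∀ z : Z, H z) (x : LocalSpace H X) :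
    glueMap H hYZ v (glueMap H hXY (fun y : Y => v ⟨y, hYZ y.2⟩) x) =
      glueMap H (hXY.trans hYZ) v x := by
  refine LinearMap.congr_fun (f := glueMap H hYZ v ∘ₗ glueMap H hXY _)
    (HilbertTensor.linearMap_ext fun u => ?_) x
  rw [LinearMap.comp_apply, glueMap_tprod, glueMap_tprod, glueMap_tprod, glue_glue hXY hYZ]

theorem localEmbedding_trans {X Y Z : Finset Λ} (hXY : X ⊆ Y) (hYZ : Y ⊆ Z)
    (T : LocalAlgebra H X) :
    localEmbedding H hYZ (localEmbedding H hXY T) = localEmbedding H (hXY.trans hYZ) T := by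
  refine ContinuousLinearMap.coe_injective (HilbertTensor.linearMap_ext fun v => ?_)
  rw [ContinuousLinearMap.coe_coe, ContinuousLinearMap.coe_coe, localEmbedding_tprod,
    localEmbedding_tprod, localEmbedding_tprod, glueMap_glueMap]

theorem localEmbedding_self {X : Finset Λ} (T : LocalAlgebra H X) :
    localEmbedding H (Finset.Subset.refl X) T = T := by
  refine ContinuousLinearMap.coe_injective (HilbertTensor.linearMap_ext fun v => ?_)
  rw [ContinuousLinearMap.coe_coe, ContinuousLinearMap.coe_coe, localEmbedding_tprod]
  change glueMap H _ v (T (.tprod v)) = _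
  refine LinearMap.congr_fun (g := LinearMap.id) (HilbertTensor.linearMap_ext fun u => ?_) _
  rw [glueMap_tprod]
  have h₁ : glue u v = u := by funext x; simp [glue]
  rw [h₁]
  rfl

end LocalAlgebras


section CStarInductiveLimit

universe u v
variable {ι : Type u} [Preorder ι] {G : ι → Type v} [∀ i, CStarAlgebra (G i)]

/-- The connecting `*`-homomorphisms are isometric. -/
class IsometricSystem (f : ∀ i j, i ≤ j → G i →⋆ₐ[ℂ] G j) : Prop where
  norm_map : ∀ i j h x, ‖f i j h x‖ = ‖x‖

variable [IsDirectedOrder ι]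
  (f : ∀ i j, i ≤ j → G i →⋆ₐ[ℂ] G j) [DirectedSystem G (f · · ·)]

/-- The union (algebraic direct limit) of a directed system of C*-algebras. -/
abbrev AlgebraicUnion : Type (max u v) := DirectLimit G f

variable [IsometricSystem f]

/-- The norm of an element of the union is its norm in any algebra of the system containing it. -/
instance : Norm (AlgebraicUnion f) where
  norm := DirectLimit.lift f (fun _ x => ‖x‖) fun i j h x => (IsometricSystem.norm_map i j h x).symm

theorem AlgebraicUnion.norm_mk (i : ι) (x : G i) :
    ‖(⟦⟨i, x⟩⟧ : AlgebraicUnion f)‖ = ‖x‖ := rfl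

variable [Nonempty ι]

/-- The norm of the union is a norm. -/
def AlgebraicUnion.groupNorm : AddGroupNorm (AlgebraicUnion f) where
  toFun x := ‖x‖
  map_zero' := by
    rw [DirectLimit.zero_def (Classical.arbitrary ι), AlgebraicUnion.norm_mk, norm_zero]
  add_le' := DirectLimit.induction₂ _ fun i x y => by
    rw [DirectLimit.add_def, AlgebraicUnion.norm_mk]; exact norm_add_le x y
  neg' := DirectLimit.induction _ fun i x => by
    rw [DirectLimit.neg_def, AlgebraicUnion.norm_mk, AlgebraicUnion.norm_mk, norm_neg]
  eq_zero_of_map_eq_zero' := DirectLimit.induction _ fun i x h => by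
    rw [AlgebraicUnion.norm_mk, norm_eq_zero] at h
    rw [h, ← DirectLimit.zero_def]

instance : NormedAddCommGroup (AlgebraicUnion f) :=
  (AlgebraicUnion.groupNorm f).toNormedAddCommGroup

instance : NormedRing (AlgebraicUnion f) where
  __ := (inferInstance : Ring (AlgebraicUnion f))
  __ := (inferInstance : NormedAddCommGroup (AlgebraicUnion f))
  norm_mul_le := DirectLimit.induction₂ _ fun i x y => by
    rw [DirectLimit.mul_def]; exact norm_mul_le x y

instance : NormedAlgebra ℂ (AlgebraicUnion f) where
  __ := (inferInstance : Algebra ℂ (AlgebraicUnion f))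
  norm_smul_le r := DirectLimit.induction _ fun i x => by
    rw [DirectLimit.smul_def]; exact norm_smul_le r x

instance : CStarRing (AlgebraicUnion f) where
  norm_mul_self_le := DirectLimit.induction _ fun i x => by
    rw [DirectLimit.star_def, DirectLimit.mul_def]; exact CStarRing.norm_mul_self_le x

end CStarInductiveLimit

section Completion
open UniformSpace

universe u
variable (A : Type u) [NormedRing A] [StarRing A]

/-- The involution extends to the completion by continuity. -/
instance : Star (Completion A) := ⟨Completion.map star⟩

theorem continuous_star_completion : Continuous (star : Completion A → Completion A) :=
  Completion.continuous_map

variable [CStarRing A]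

variable {A} in
theorem coe_star (a : A) : ((star a : A) : Completion A) = star (a : Completion A) :=
  (Completion.map_coe (star_isometry (E := A)).uniformContinuous a).symm

instance : StarRing (Completion A) where
  star_involutive x := by
    induction x using Completion.induction_on with
    | hp =>
      have := continuous_star_completion A
      exact isClosed_eq (by fun_prop) (by fun_prop)
    | ih a => rw [← coe_star, ← coe_star, star_star]
  star_mul x y := by
    induction x, y using Completion.induction_on₂ with
    | hp =>
      have := continuous_star_completion A
      exact isClosed_eq (by fun_prop) (by fun_prop)
    | ih a b => rw [← Completion.coe_mul, ← coe_star, star_mul, Completion.coe_mul, coe_star, coe_star]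
  star_add x y := by
    induction x, y using Completion.induction_on₂ with
    | hp =>
      have := continuous_star_completion A
      exact isClosed_eq (by fun_prop) (by fun_prop)
    | ih a b => rw [← Completion.coe_add, ← coe_star, star_add, Completion.coe_add, coe_star, coe_star]

instance : CStarRing (Completion A) where
  norm_mul_self_le x := by
    induction x using Completion.induction_on with
    | hp =>
      have := continuous_star_completion A
      exact isClosed_le (by fun_prop) (by fun_prop)
    | ih a =>
      rw [← coe_star, ← Completion.coe_mul, Completion.norm_coe, Completion.norm_coe]
      exact CStarRing.norm_mul_self_le a

variable [NormedAlgebra ℂ A] [StarModule ℂ A]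

instance : NormedAlgebra ℂ (Completion A) where
  norm_smul_le := norm_smul_le

instance : StarModule ℂ (Completion A) where
  star_smul r x := by
    induction x using Completion.induction_on with
    | hp =>
      have h := continuous_star_completion A
      exact isClosed_eq (h.comp (continuous_const_smul r)) ((continuous_const_smul (star r)).comp h)
    | ih a =>
      have h (c : ℂ) (b : A) : ((c • b : A) : Completion A) = c • (b : Completion A) :=
        Completion.coe_smul c b
      rw [← h, ← coe_star, star_smul, h, coe_star]

instance : CStarAlgebra (Completion A) where

end Completion

section CStarLimit

universe u v
variable {ι : Type u} [Preorder ι] [IsDirectedOrder ι] [Nonempty ι]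
  {G : ι → Type v} [∀ i, CStarAlgebra (G i)]
  (f : ∀ i j, i ≤ j → G i →⋆ₐ[ℂ] G j) [DirectedSystem G (f · · ·)] [IsometricSystem f]

/-- The norm completion of the union of a directed system of C*-algebras. -/
def CStarLimit : Type (max u v) := UniformSpace.Completion (AlgebraicUnion f)

instance : CStarAlgebra (CStarLimit f) :=
  inferInstanceAs (CStarAlgebra (UniformSpace.Completion (AlgebraicUnion f)))

/-- The canonical embedding of a member of the system. -/
def CStarLimit.of (i : ι) : G i →⋆ₐ[ℂ] CStarLimit f where
  toFun x := ((⟦⟨i, x⟩⟧ : AlgebraicUnion f) : UniformSpace.Completion (AlgebraicUnion f))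
  map_one' := by
    rw [← DirectLimit.one_def]; exact UniformSpace.Completion.coe_one _
  map_mul' x y := by
    rw [← DirectLimit.mul_def]; exact UniformSpace.Completion.coe_mul _ _
  map_zero' := by
    rw [← DirectLimit.zero_def]; exact UniformSpace.Completion.coe_zero
  map_add' x y := by
    rw [← DirectLimit.add_def]; exact UniformSpace.Completion.coe_add _ _
  commutes' c := by
    change ((⟦⟨i, algebraMap ℂ (G i) c⟩⟧ : AlgebraicUnion f) :
      UniformSpace.Completion (AlgebraicUnion f)) = _
    rw [← DirectLimit.algebraMap_def]; rfl
  map_star' x := by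
    rw [← DirectLimit.star_def]; exact coe_star _

theorem CStarLimit.norm_of (i : ι) (x : G i) : ‖CStarLimit.of f i x‖ = ‖x‖ :=
  UniformSpace.Completion.norm_coe (E := AlgebraicUnion f) _

theorem CStarLimit.of_map {i j : ι} (h : i ≤ j) (x : G i) :
    CStarLimit.of f j (f i j h x) = CStarLimit.of f i x :=
  congrArg ((↑) : AlgebraicUnion f → UniformSpace.Completion (AlgebraicUnion f))
    (DirectLimit.eq_of_le (f := f) ⟨i, x⟩ j h).symm

theorem CStarLimit.dense_range_of : Dense (⋃ i, Set.range (CStarLimit.of f i)) := by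
  refine (UniformSpace.Completion.denseRange_coe (α := AlgebraicUnion f)).mono ?_
  rintro _ ⟨z, rfl⟩
  obtain ⟨i, x, rfl⟩ := DirectLimit.exists_eq_mk _ z
  exact Set.mem_iUnion.mpr ⟨i, x, rfl⟩

end CStarLimit


section QuasiLocal

universe u v
variable {Λ : Type u} (H : Λ → Type v) [∀ x, NormedAddCommGroup (H x)]
  [∀ x, InnerProductSpace ℂ (H x)] [∀ x, FiniteDimensional ℂ (H x)]

instance : IsDirectedOrder (Finset Λ) := by
  classical
  exact ⟨fun X Y => ⟨X ∪ Y, Finset.subset_union_left, Finset.subset_union_right⟩⟩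

/-- The directed system of the local observable algebras, indexed by the finite sets of sites. -/
abbrev localSystem (X Y : Finset Λ) (h : X ≤ Y) : LocalAlgebra H X →⋆ₐ[ℂ] LocalAlgebra H Y :=
  localEmbedding H h

instance : DirectedSystem (LocalAlgebra H) (localSystem H · · ·) where
  map_self _ T := localEmbedding_self H T
  map_map _ _ _ hXY hYZ T := localEmbedding_trans H hXY hYZ T

variable [∀ x, Nontrivial (H x)]

instance : IsometricSystem (localSystem H) where
  norm_map _ _ h T :=
    NonUnitalStarAlgHom.norm_map (localEmbedding H h) (localEmbedding_injective H h) T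

/-- The quasi-local C*-algebra: the norm completion of the union of the local observable algebras. -/
def QuasiLocalAlgebra : Type (max u v) := CStarLimit (localSystem H)

instance : CStarAlgebra (QuasiLocalAlgebra H) := inferInstanceAs (CStarAlgebra (CStarLimit _))

/-- The embedding of the observables supported in `X` into the quasi-local algebra. -/
def localObservable (X : Finset Λ) : LocalAlgebra H X →⋆ₐ[ℂ] QuasiLocalAlgebra H :=
  CStarLimit.of (localSystem H) X

theorem norm_localObservable (X : Finset Λ) (T : LocalAlgebra H X) :
    ‖localObservable H X T‖ = ‖T‖ :=
  CStarLimit.norm_of (localSystem H) X T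

theorem localObservable_localEmbedding {X Y : Finset Λ} (h : X ⊆ Y) (T : LocalAlgebra H X) :
    localObservable H Y (localEmbedding H h T) = localObservable H X T :=
  CStarLimit.of_map (localSystem H) h T

theorem dense_localObservable :
    Dense (⋃ X : Finset Λ, Set.range (localObservable H X)) :=
  CStarLimit.dense_range_of (localSystem H)

end QuasiLocal

section Dynamics

open scoped ENNReal

universe u v

/-- `F : [0, ∞) → (0, ∞)` is non-increasing, uniformly integrable over `Λ`, and satisfies the
convolution condition. Values of `F` at negative arguments play no role. The suprema and the sums of
non-negative terms are taken in `[0, ∞]`. -/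
structure IsDecayFunction (Λ : Type u) [MetricSpace Λ] (F : ℝ → ℝ) : Prop where
  pos : ∀ r, 0 ≤ r → 0 < F r
  antitone : AntitoneOn F (Set.Ici 0)
  integrable : (⨆ x : Λ, ∑' y : Λ, ENNReal.ofReal (F (dist x y))) < ∞
  convolution : (⨆ (x : Λ) (y : Λ), ∑' z : Λ,
    ENNReal.ofReal (F (dist x z) * F (dist z y) / F (dist x y))) < ∞

/-- `F_a(r) = e^{-a r} F(r)`. -/
def weightedDecay (F : ℝ → ℝ) (a r : ℝ) : ℝ := Real.exp (-a * r) * F r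

variable {Λ : Type u} (H : Λ → Type v) [∀ x, NormedAddCommGroup (H x)]
  [∀ x, InnerProductSpace ℂ (H x)] [∀ x, FiniteDimensional ℂ (H x)]

/-- An interaction: a self-adjoint observable `Φ(X)` supported in `X` for each finite set `X`. -/
structure Interaction where
  term : ∀ X : Finset Λ, LocalAlgebra H X
  isSelfAdjoint : ∀ X, IsSelfAdjoint (term X)

variable {H}

/-- `‖Φ‖_a = sup_{x, y} ∑_{X ∋ x, y} ‖Φ(X)‖ / F_a(d(x, y))`, in `[0, ∞]`. -/
def interactionNorm [MetricSpace Λ] (F : ℝ → ℝ) (a : ℝ) (Φ : Interaction H) : ℝ≥0∞ :=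
  ⨆ (x : Λ) (y : Λ), ∑' X : {X : Finset Λ // x ∈ X ∧ y ∈ X},
    ENNReal.ofReal (‖Φ.term X‖ / weightedDecay F a (dist x y))

variable (H) in
/-- The set `B_a(Λ)` of the interactions with `‖Φ‖_a < ∞`. -/
def boundedInteractions [MetricSpace Λ] (F : ℝ → ℝ) (a : ℝ) : Set (Interaction H) :=
  {Φ | interactionNorm F a Φ < ∞}

variable [∀ x, Nontrivial (H x)]

/-- The finite-volume Hamiltonian `∑_{X ⊆ Y} Φ(X)`. -/
def localHamiltonian (Φ : Interaction H) (Y : Finset Λ) : QuasiLocalAlgebra H :=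
  ∑ X ∈ Y.powerset, localObservable H X (Φ.term X)

/-- The finite-volume dynamics `A ↦ e^{itH} A e^{-itH}`, with `H` the Hamiltonian of `Y`. -/
def finiteVolumeDynamics (Φ : Interaction H) (Y : Finset Λ) (t : ℝ) (A : QuasiLocalAlgebra H) :
    QuasiLocalAlgebra H :=
  NormedSpace.exp ((Complex.I * t) • localHamiltonian Φ Y) * A *
    NormedSpace.exp (-(Complex.I * t) • localHamiltonian Φ Y)

/-- A strongly continuous one-parameter group of `*`-automorphisms. -/
structure IsStronglyContinuousGroup {𝒜 : Type*} [CStarAlgebra 𝒜] (τ : ℝ → 𝒜 ≃⋆ₐ[ℂ] 𝒜) :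
    Prop where
  map_zero : ∀ A, τ 0 A = A
  map_add : ∀ s t A, τ (s + t) A = τ s (τ t A)
  continuous : ∀ A, Continuous fun t => τ t A

/-- An increasing sequence of finite subsets whose union is everything. -/
structure IsExhausting (V : ℕ → Finset Λ) : Prop where
  monotone : Monotone V
  exhausts : ∀ x, ∃ n, x ∈ V n

end Dynamics

end QuantumSpin

end

/-! The finite-volume evolutions of a fixed observable form a Cauchy net over the finite sets of
sites, uniformly on bounded time intervals. By density of the local observables and isometry of the
evolutions it suffices to treat an observable `B` supported in a finite set `X`.

For `V ⊆ W`, Duhamel's formula (`norm_evolution_sub_evolution_le`) bounds the difference of the two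
evolutions of `B` by the commutators of the terms `Φ(Y)`, with `Y ⊆ W` and `Y ⊄ V`, with the
`V`-evolution of `B`. A Lieb-Robinson bound (`norm_bracket_evolution_le`) controls each of them by
`v(Y) e^{2K|t|}` up to a constant, with `v(Y) = ‖Φ(Y)‖ ∑_{y ∈ Y} w(y)` and `w(y) = ∑_{x ∈ X}
F(d(y,x))`. The constant `K` does not depend on the volume.

The Lieb-Robinson bound comes from Gronwall's inequality for the whole vector of commutators,
measured in the sup norm with weights `v`, and not from an iterated series. It needs only that `v`
is a supersolution: `2‖Φ(Y)‖ ∑_{Z ∩ Y ≠ ∅} v(Z) ≤ 2K v(Y)`. This follows from `∑_{Z ∋ z} v(Z) ≤ K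
w(z)` (`exists_sum_termWeight_le`), where the convolution condition on `F` enters. As every `Y` in
the Duhamel sum meets `W \ V`, the same inequality bounds the sum by `K ∑_{z ∈ W \ V} w(z)`, which
is small for large `V` because `w` is summable.

The limit inherits the algebraic structure and the group law, and is strongly continuous as a
locally uniform limit. Uniqueness uses that `Λ` is countable, so that an exhausting sequence exists.
-/

namespace QuantumSpin

/-! ### Inner evolutions of a C*-algebra and Duhamel's estimate -/

section Evolution

open NormedSpace

variable {𝒜 : Type*} [CStarAlgebra 𝒜]

/-- The commutator `A B - B A`. -/
def bracket (A B : 𝒜) : 𝒜 := A * B - B * A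

theorem bracket_neg_left (A B : 𝒜) : bracket (-A) B = -bracket A B := by
  simp only [bracket, neg_mul, mul_neg]; abel

theorem bracket_sub_left (A A' B : 𝒜) : bracket (A - A') B = bracket A B - bracket A' B := by
  simp only [bracket, sub_mul, mul_sub]; abel

theorem bracket_sum_left {ι : Type*} (s : Finset ι) (a : ι → 𝒜) (B : 𝒜) :
    bracket (∑ i ∈ s, a i) B = ∑ i ∈ s, bracket (a i) B := by
  simp only [bracket, Finset.sum_mul, Finset.mul_sum, Finset.sum_sub_distrib]

theorem bracket_eq_zero {A B : 𝒜} (h : Commute A B) : bracket A B = 0 := sub_eq_zero.mpr h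

/-- The evolution `A ↦ e^{ith} A e^{-ith}` generated by `h`. -/
noncomputable def evolution (h : 𝒜) (t : ℝ) (A : 𝒜) : 𝒜 :=
  exp ((Complex.I * t) • h) * A * exp (-(Complex.I * t) • h)

theorem exp_neg_mul_exp_I_smul (h : 𝒜) (t : ℝ) :
    exp (-(Complex.I * t) • h) * exp ((Complex.I * t) • h) = 1 := by
  let _ : NormedAlgebra ℚ 𝒜 := NormedAlgebra.restrictScalars ℚ ℂ 𝒜
  rw [← exp_add_of_commute (by rw [neg_smul]; exact (Commute.refl _).neg_left), neg_smul,
    neg_add_cancel, exp_zero]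

theorem exp_mul_exp_neg_I_smul (h : 𝒜) (t : ℝ) :
    exp ((Complex.I * t) • h) * exp (-(Complex.I * t) • h) = 1 := by
  simpa using exp_neg_mul_exp_I_smul h (-t)

theorem evolution_zero (h A : 𝒜) : evolution h 0 A = A := by
  simp [evolution]

theorem evolution_neg (h : 𝒜) (t : ℝ) (A : 𝒜) : evolution (-h) t A = evolution h (-t) A := by
  simp [evolution]

theorem evolution_add (h : 𝒜) (t : ℝ) (A B : 𝒜) :
    evolution h t (A + B) = evolution h t A + evolution h t B := by
  simp [evolution, mul_add, add_mul]

theorem evolution_sub (h : 𝒜) (t : ℝ) (A B : 𝒜) :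
    evolution h t (A - B) = evolution h t A - evolution h t B := by
  simp [evolution, mul_sub, sub_mul]

theorem evolution_smul (h : 𝒜) (t : ℝ) (c : ℂ) (A : 𝒜) :
    evolution h t (c • A) = c • evolution h t A := by
  simp [evolution]

theorem evolution_mul (h : 𝒜) (t : ℝ) (A B : 𝒜) :
    evolution h t (A * B) = evolution h t A * evolution h t B := by
  have e := exp_neg_mul_exp_I_smul h t
  simp only [evolution]
  calc _ = exp ((Complex.I * t) • h) * A * 1 * B * exp (-(Complex.I * t) • h) := by
        simp only [mul_one, mul_assoc]
    _ = _ := by rw [← e]; simp only [mul_assoc]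

theorem evolution_evolution (h : 𝒜) (s t : ℝ) (A : 𝒜) :
    evolution h s (evolution h t A) = evolution h (s + t) A := by
  let _ : NormedAlgebra ℚ 𝒜 := NormedAlgebra.restrictScalars ℚ ℂ 𝒜
  have key (c d : ℂ) : exp ((c + d) • h) = exp (c • h) * exp (d • h) := by
    rw [add_smul, exp_add_of_commute (((Commute.refl h).smul_left c).smul_right d)]
  have e₁ : Complex.I * ((s + t : ℝ) : ℂ) = Complex.I * s + Complex.I * t := by push_cast; ring
  have e₂ : -(Complex.I * s + Complex.I * t) = -(Complex.I * t) + -(Complex.I * s) := by ring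
  simp only [evolution]
  rw [e₁, e₂, key, key]
  simp only [mul_assoc]

theorem evolution_of_commute {h : 𝒜} {A : 𝒜} (hA : Commute A h) (t : ℝ) :
    evolution h t A = A := by
  rw [evolution, ((hA.symm.smul_left _).exp_left).eq, mul_assoc, exp_mul_exp_neg_I_smul, mul_one]

theorem evolution_star {h : 𝒜} (hh : IsSelfAdjoint h) (t : ℝ) (A : 𝒜) :
    evolution h t (star A) = star (evolution h t A) := by
  simp only [evolution, star_mul, star_exp, star_smul, hh.star_eq]
  simp [mul_assoc, mul_comm (t : ℂ)]

theorem norm_evolution {h : 𝒜} (hh : IsSelfAdjoint h) (t : ℝ) (A : 𝒜) :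
    ‖evolution h t A‖ = ‖A‖ := by
  have hs : star (exp ((Complex.I * t) • h)) = exp (-(Complex.I * t) • h) := by
    simp [star_exp, hh.star_eq]
  have hu : exp ((Complex.I * t) • h) ∈ unitary 𝒜 := by
    rw [Unitary.mem_iff, hs]
    exact ⟨exp_neg_mul_exp_I_smul h t, exp_mul_exp_neg_I_smul h t⟩
  have hu' : exp (-(Complex.I * t) • h) ∈ unitary 𝒜 := hs ▸ Unitary.star_mem hu
  rw [evolution, CStarRing.norm_mul_mem_unitary _ hu', CStarRing.norm_mem_unitary_mul _ hu]

/-- The argument may depend on time, so this is the interaction-picture derivative: it serves to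
compare two evolutions and to remove part of a generator by a rotation. -/
theorem hasDerivAt_evolution (h : 𝒜) {f : ℝ → 𝒜} {f' : 𝒜} {t : ℝ} (hf : HasDerivAt f f' t) :
    HasDerivAt (fun s => evolution h s (f s))
      (evolution h t (f' + Complex.I • (bracket h (f t)))) t := by
  have e₁ : HasDerivAt (fun s : ℝ => exp ((Complex.I * s) • h))
      (exp ((Complex.I * t) • h) * (Complex.I • h)) t := by
    have := hasDerivAt_exp_smul_const (𝕂 := ℝ) (Complex.I • h) t
    simpa [mul_comm Complex.I, mul_smul] using this
  have e₂ : HasDerivAt (fun s : ℝ => exp (-(Complex.I * s) • h))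
      (-(Complex.I • h) * exp (-(Complex.I * t) • h)) t := by
    have := hasDerivAt_exp_smul_const' (𝕂 := ℝ) (-(Complex.I • h)) t
    simpa [mul_comm Complex.I, mul_smul] using this
  refine ((e₁.mul hf).mul e₂).congr_deriv ?_
  simp only [evolution, bracket, Pi.mul_apply, mul_add, add_mul, smul_sub, mul_sub, sub_mul, mul_assoc,
    smul_mul_assoc, mul_smul_comm, neg_mul, mul_neg]
  abel

theorem hasDerivAt_evolution_const (h A : 𝒜) (t : ℝ) :
    HasDerivAt (fun s => evolution h s A) (Complex.I • (bracket h (evolution h t A))) t := by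
  convert hasDerivAt_evolution h (hasDerivAt_const t A) using 1
  have c₁ : Commute h (exp ((Complex.I * t) • h)) :=
    ((Commute.refl h).smul_right _).exp_right
  have c₂ : Commute h (exp (-(Complex.I * t) • h)) :=
    ((Commute.refl h).smul_right _).exp_right
  rw [zero_add, evolution_smul, bracket, bracket, evolution_sub]
  congr 2
  · simp only [evolution, ← mul_assoc, c₁.eq]
  · simp only [evolution, mul_assoc, c₂.eq]

theorem continuous_evolution (h A : 𝒜) : Continuous fun t => evolution h t A :=
  continuous_iff_continuousAt.mpr fun t => (hasDerivAt_evolution_const h A t).continuousAt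

theorem norm_bracket_le_two_mul (A B : 𝒜) : ‖(bracket A B)‖ ≤ 2 * ‖A‖ * ‖B‖ := by
  rw [bracket]
  refine (norm_sub_le _ _).trans ?_
  linarith [norm_mul_le A B, norm_mul_le B A, mul_comm ‖A‖ ‖B‖]

/-- Duhamel estimate for the difference of two evolutions. -/
theorem norm_evolution_sub_evolution_le_of_nonneg {h k : 𝒜} (hk : IsSelfAdjoint k) (B : 𝒜)
    {t C : ℝ} (ht : 0 ≤ t) (hC : ∀ s ∈ Set.Ico 0 t, ‖(bracket (k - h) (evolution h s B))‖ ≤ C) :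
    ‖evolution k t B - evolution h t B‖ ≤ C * t := by
  -- With the inverse `k`-evolution outside, the derivative involves only the commutator of `k - h`
  -- with the `h`-evolution of `B`, and the outer evolution does not change its norm.
  set g : ℝ → 𝒜 := fun s => evolution (-k) s (evolution h s B)
  have hg (s : ℝ) : HasDerivAt g (evolution (-k) s (-(Complex.I • (bracket (k - h) (evolution h s B))))) s := by
    refine (hasDerivAt_evolution (-k) (hasDerivAt_evolution_const h B s)).congr_deriv ?_
    rw [bracket_sub_left, bracket_neg_left, ← smul_neg, ← smul_add]
    congr 2
    abel
  have := norm_image_sub_le_of_norm_deriv_right_le_segment (f := g) (C := C) (a := 0) (b := t)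
    (fun s _ => (hg s).continuousAt.continuousWithinAt) (fun s _ => (hg s).hasDerivWithinAt)
    (fun s hs => by
      rw [norm_evolution hk.neg, norm_neg, norm_smul, Complex.norm_I, one_mul]; exact hC s hs)
    t ⟨ht, le_rfl⟩
  have e : evolution h t B = evolution k t (g t) := by
    simp only [g, evolution_neg, evolution_evolution, add_neg_cancel, evolution_zero]
  have e₀ : g 0 = B := by simp only [g, evolution_zero]
  rw [e, ← evolution_sub, norm_evolution hk, norm_sub_rev]
  simpa [e₀] using this

theorem norm_evolution_sub_evolution_le {h k : 𝒜} (hk : IsSelfAdjoint k) (B : 𝒜) {t C : ℝ}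
    (hC : ∀ s, |s| ≤ |t| → ‖(bracket (k - h) (evolution h s B))‖ ≤ C) :
    ‖evolution k t B - evolution h t B‖ ≤ C * |t| := by
  rcases le_total 0 t with ht | ht
  · rw [abs_of_nonneg ht]
    refine norm_evolution_sub_evolution_le_of_nonneg hk B ht fun s hs => hC s ?_
    rw [abs_of_nonneg hs.1, abs_of_nonneg ht]; exact hs.2.le
  -- Negative times reduce to positive ones by changing the sign of both generators.
  · have := norm_evolution_sub_evolution_le_of_nonneg (h := -h) hk.neg B (t := -t) (C := C)
      (by linarith) fun s hs => ?_
    · simpa [evolution_neg, abs_of_nonpos ht] using this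
    · rw [evolution_neg, show -k - -h = -(k - h) by abel, bracket_neg_left, norm_neg]
      refine hC _ ?_
      rw [abs_neg, abs_of_nonneg hs.1, abs_of_nonpos ht]; exact hs.2.le

end Evolution

/-! ### An abstract Lieb-Robinson bound by Gronwall's inequality -/

section LiebRobinson

variable {𝒜 : Type*} [CStarAlgebra 𝒜] {ι : Type*}

/-- The part of the Hamiltonian commuting with `a i` only rotates the commutator of `a i` with the
evolved `B` and leaves its norm unchanged. Only the terms near `i` make it grow, at a rate governed
by their own commutators. The supersolution condition `hvκ` closes this linear system in the
weighted sup norm. -/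
theorem norm_bracket_evolution_le_of_nonneg {a : ι → 𝒜} (ha : ∀ i, IsSelfAdjoint (a i))
    (V : Finset ι) (r : ι → ι → Prop) [DecidableRel r]
    (hr : ∀ i j, ¬ r i j → Commute (a i) (a j)) {v : ι → ℝ} (hv : ∀ i, 0 ≤ v i)
    (hv₀ : ∀ i, v i = 0 → ∀ b, Commute (a i) b) {κ : ℝ} (hκ : 0 ≤ κ)
    (hvκ : ∀ i, 2 * ‖a i‖ * ∑ j ∈ V with r i j, v j ≤ κ * v i) {B : 𝒜} {M : ℝ}
    (hB : ∀ i, ‖(bracket (a i) B)‖ ≤ M * v i) {t : ℝ} (ht : 0 ≤ t) (i : ι) :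
    ‖(bracket (a i) (evolution (∑ j ∈ V, a j) t B))‖ ≤ M * v i * Real.exp (κ * t) := by
  classical
  -- The index `i` may lie outside `V`: in the application the term is one absent from the
  -- Hamiltonian.
  set S : Finset ι := insert i V with hS
  have hM : 0 ≤ M ∨ v i = 0 := by
    rcases (hv i).eq_or_lt with h | h
    · exact .inr h.symm
    · exact .inl (nonneg_of_mul_nonneg_left ((norm_nonneg _).trans (hB i)) h)
  rcases hM.symm with h0 | hM
  · rw [bracket_eq_zero (hv₀ i h0 _), h0]; simp
  set h : 𝒜 := ∑ j ∈ V, a j with hh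
  set near : ι → 𝒜 := fun i => ∑ j ∈ V with r i j, a j with hnear
  set far : ι → 𝒜 := fun i => ∑ j ∈ V with ¬ r i j, a j with hfar
  have hsum (i : ι) : near i + far i = h := Finset.sum_filter_add_sum_filter_not _ _ _
  have hfarC (i : ι) : Commute (a i) (far i) :=
    Commute.sum_right _ _ _ fun j hj => hr i j (Finset.mem_filter.mp hj).2
  have hfarS (i : ι) : IsSelfAdjoint (far i) := by
    simp only [hfar, IsSelfAdjoint, star_sum, fun i => (ha i).star_eq]
  set b : ℝ → 𝒜 := fun s => evolution h s B with hb
  -- Each component is rotated by its own `far j`. Where `v j = 0` the inverse is `0` in Lean, and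
  -- nothing is lost since `a j` is central by `hv₀`.
  set ψ : ℝ → S → 𝒜 := fun s j => ((v j)⁻¹ : ℝ) • evolution (-far j) s (bracket (a j) (b s)) with hψ
  set ψ' : ℝ → S → 𝒜 := fun s j =>
    ((v j)⁻¹ : ℝ) • evolution (-far j) s (Complex.I • (bracket (a j) ((bracket (near j) (b s))))) with hψ'
  have hderiv (s : ℝ) : HasDerivAt ψ (ψ' s) s := by
    rw [hasDerivAt_pi]
    intro j
    refine HasDerivAt.const_smul _ ?_
    have hb' : HasDerivAt (fun s => (bracket (a j) (b s))) ((bracket (a j : 𝒜) (Complex.I • (bracket h (b s))))) s := by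
      have := hasDerivAt_evolution_const h B s
      exact (this.const_mul (a j)).sub (this.mul_const (a j))
    -- By the Jacobi identity and `[a j, far j] = 0`, `[a j, [far j, b]] = [far j, [a j, b]]`. The
    -- rotation cancels exactly this term, leaving only `near j`.
    refine (hasDerivAt_evolution (-far j) hb').congr_deriv (congrArg _ ?_)
    have hc : far j * a j = a j * far j := (hfarC j).eq.symm
    rw [← hsum j]
    simp only [bracket, mul_smul_comm, smul_mul_assoc, ← smul_sub, ← smul_add]
    congr 1
    have e₁ : a j * (far j * b s) = far j * (a j * b s) := by rw [← mul_assoc, ← hc, mul_assoc]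
    have e₂ : b s * far j * a j = b s * a j * far j := by rw [mul_assoc, hc, ← mul_assoc]
    simp only [add_mul, mul_add, mul_sub, sub_mul, neg_mul, mul_neg, e₁, e₂]
    simp only [mul_assoc]
    abel
  have hnorm (s : ℝ) (j : S) : ‖(bracket (a j) (b s))‖ ≤ v j * ‖ψ s‖ := by
    rcases (hv j).eq_or_lt with h0 | h0
    · rw [bracket_eq_zero (hv₀ j h0.symm _), ← h0]; simp
    · have := norm_le_pi_norm (ψ s) j
      rw [hψ, norm_smul, norm_evolution (hfarS j).neg, Real.norm_of_nonneg (inv_nonneg.2 h0.le),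
        inv_mul_le_iff₀ h0] at this
      exact this
  have hbound (s : ℝ) : ‖ψ' s‖ ≤ κ * ‖ψ s‖ := by
    refine (pi_norm_le_iff_of_nonneg (by positivity)).mpr fun j => ?_
    rw [hψ', norm_smul, norm_evolution (hfarS j).neg, Real.norm_of_nonneg (inv_nonneg.2 (hv j)),
      norm_smul, Complex.norm_I, one_mul]
    rcases (hv j).eq_or_lt with h0 | h0
    · rw [← h0]; simp; positivity
    rw [inv_mul_le_iff₀ h0]
    have h₁ : ‖(bracket (near j) (b s))‖ ≤ (∑ k ∈ V with r j k, v k) * ‖ψ s‖ := by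
      rw [bracket_sum_left, Finset.sum_mul]
      refine norm_sum_le_of_le _ fun k hk => ?_
      exact hnorm s ⟨k, Finset.mem_insert_of_mem (Finset.mem_filter.mp hk).1⟩
    calc _ ≤ 2 * ‖a j‖ * ‖(bracket (near j) (b s))‖ := norm_bracket_le_two_mul _ _
      _ ≤ 2 * ‖a j‖ * ((∑ k ∈ V with r j k, v k) * ‖ψ s‖) := by gcongr
      _ = (2 * ‖a j‖ * ∑ k ∈ V with r j k, v k) * ‖ψ s‖ := by ring
      _ ≤ κ * v j * ‖ψ s‖ := by gcongr ?_ * _; exact hvκ j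
      _ = _ := by ring
  have h0 : ‖ψ 0‖ ≤ M := by
    refine (pi_norm_le_iff_of_nonneg hM).mpr fun j => ?_
    rw [hψ, norm_smul, norm_evolution (hfarS j).neg, Real.norm_of_nonneg (inv_nonneg.2 (hv j)),
      show b 0 = B from evolution_zero h B]
    rcases (hv j).eq_or_lt with h0 | h0
    · rw [← h0]; simpa using hM
    · rw [inv_mul_le_iff₀ h0, mul_comm]; exact hB j
  have hg := norm_le_gronwallBound_of_norm_deriv_right_le (f := ψ) (f' := ψ') (δ := M) (K := κ)
    (ε := 0) (a := 0) (b := t) (fun s _ => (hderiv s).continuousAt.continuousWithinAt)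
    (fun s _ => (hderiv s).hasDerivWithinAt) h0 (fun s _ => by rw [add_zero]; exact hbound s) t
    ⟨ht, le_rfl⟩
  rw [gronwallBound_ε0, sub_zero] at hg
  calc _ ≤ v i * ‖ψ t‖ := hnorm t ⟨i, Finset.mem_insert_self i V⟩
    _ ≤ v i * (M * Real.exp (κ * t)) := by gcongr; exact hv i
    _ = _ := by ring

/-- A Lieb-Robinson bound: if the weights `v` are a supersolution of the comparison system of a
finite family of interaction terms, they bound the commutators of the terms with the evolved
observable. -/
theorem norm_bracket_evolution_le {a : ι → 𝒜} (ha : ∀ i, IsSelfAdjoint (a i))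
    (V : Finset ι) (r : ι → ι → Prop) [DecidableRel r]
    (hr : ∀ i j, ¬ r i j → Commute (a i) (a j)) {v : ι → ℝ} (hv : ∀ i, 0 ≤ v i)
    (hv₀ : ∀ i, v i = 0 → ∀ b, Commute (a i) b) {κ : ℝ} (hκ : 0 ≤ κ)
    (hvκ : ∀ i, 2 * ‖a i‖ * ∑ j ∈ V with r i j, v j ≤ κ * v i) {B : 𝒜} {M : ℝ}
    (hB : ∀ i, ‖(bracket (a i) B)‖ ≤ M * v i) (t : ℝ) (i : ι) :
    ‖(bracket (a i) (evolution (∑ j ∈ V, a j) t B))‖ ≤ M * v i * Real.exp (κ * |t|) := by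
  rcases le_total 0 t with ht | ht
  · rw [abs_of_nonneg ht]
    exact norm_bracket_evolution_le_of_nonneg ha V r hr hv hv₀ hκ hvκ hB ht i
  · have := norm_bracket_evolution_le_of_nonneg (a := fun i => -a i) (fun i => (ha i).neg) V r
      (fun i j h => (hr i j h).neg_left.neg_right) hv (fun i h b => (hv₀ i h b).neg_left) hκ
      (by simpa using hvκ) (B := B) (M := M)
      (by simpa [bracket_neg_left] using hB) (t := -t) (by linarith) i
    rw [Finset.sum_neg_distrib, evolution_neg, neg_neg, bracket_neg_left, norm_neg] at this
    rwa [abs_of_nonpos ht]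

end LiebRobinson

/-! ### Commutation of observables with disjoint supports -/

section Locality

universe u v
variable {Λ : Type u} {H : Λ → Type v} [∀ x, NormedAddCommGroup (H x)]
  [∀ x, InnerProductSpace ℂ (H x)] [∀ x, FiniteDimensional ℂ (H x)]

theorem localEmbedding_commute_of_disjoint {X Y Z : Finset Λ} (hX : X ⊆ Z) (hY : Y ⊆ Z)
    (hXY : Disjoint X Y) (T : LocalAlgebra H X) (S : LocalAlgebra H Y) :
    Commute (localEmbedding H hX T) (localEmbedding H hY S) := by
  refine ContinuousLinearMap.coe_injective (HilbertTensor.linearMap_ext fun v => ?_)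
  change localEmbedding H hX T (localEmbedding H hY S (.tprod v)) =
    localEmbedding H hY S (localEmbedding H hX T (.tprod v))
  rw [localEmbedding_tprod H hY, localEmbedding_tprod H hX]
  set ξ := T (.tprod fun x : X => v ⟨x, hX x.2⟩) with hξ
  -- `L` inserts `η` on `Y` and leaves the `X`-factor free, so that `T` can act after the insertion.
  -- It is built by linearity from elementary `η`, where disjointness makes the order of the two
  -- insertions irrelevant.
  have key (η : LocalSpace H Y) : ∃ L : LocalSpace H X →ₗ[ℂ] LocalSpace H Z,
      (∀ u, L (.tprod u) = glueMap H hY (glue u v) η) ∧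
        L ξ = localEmbedding H hX T (glueMap H hY v η) := by
    have hη : η ∈ Submodule.span ℂ
        (Set.range (HilbertTensor.tprod (E := fun y : Y => H y))) := by
      rw [HilbertTensor.span_tprod]; trivial
    induction hη using Submodule.span_induction with
    | mem η hη =>
      obtain ⟨w, rfl⟩ := hη
      refine ⟨glueMap H hX (glue w v), fun u => ?_, ?_⟩
      · rw [glueMap_tprod, glueMap_tprod]
        congr 1
        funext z
        by_cases h₁ : (z : Λ) ∈ X
        · simp [glue, h₁, Finset.disjoint_left.mp hXY h₁]
        · simp [glue, h₁]
      · rw [glueMap_tprod, localEmbedding_tprod, hξ]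
        congr 3
        funext x
        simp [glue, Finset.disjoint_left.mp hXY x.2]
    | zero => exact ⟨0, by simp, by simp⟩
    | add η η' _ _ h h' =>
      obtain ⟨L, h₁, h₂⟩ := h
      obtain ⟨L', h₁', h₂'⟩ := h'
      exact ⟨L + L', by simp [h₁, h₁'], by simp [h₂, h₂']⟩
    | smul c η _ h =>
      obtain ⟨L, h₁, h₂⟩ := h
      exact ⟨c • L, by simp [h₁], by simp [h₂]⟩
  obtain ⟨L, h₁, h₂⟩ := key (S (.tprod fun y : Y => v ⟨y, hY y.2⟩))
  rw [← h₂]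
  refine LinearMap.congr_fun (g := (localEmbedding H hY S).toLinearMap ∘ₗ glueMap H hX v)
    (HilbertTensor.linearMap_ext fun u => ?_) ξ
  rw [h₁, LinearMap.comp_apply, glueMap_tprod]
  change _ = localEmbedding H hY S _
  rw [localEmbedding_tprod]
  congr 3
  funext y
  simp [glue, Finset.disjoint_right.mp hXY y.2]

variable [∀ x, Nontrivial (H x)]

theorem localObservable_commute_of_disjoint {X Y : Finset Λ} (hXY : Disjoint X Y)
    (T : LocalAlgebra H X) (S : LocalAlgebra H Y) :
    Commute (localObservable H X T) (localObservable H Y S) := by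
  classical
  rw [← localObservable_localEmbedding H (Finset.subset_union_left (s₂ := Y)) T,
    ← localObservable_localEmbedding H (Finset.subset_union_right (s₁ := X)) S]
  exact (localEmbedding_commute_of_disjoint _ _ hXY T S).map (localObservable H (X ∪ Y))

/-- The empty set is disjoint from every support, so density of the local observables suffices. -/
theorem localObservable_empty_commute (T : LocalAlgebra H ∅) (A : QuasiLocalAlgebra H) :
    Commute (localObservable H ∅ T) A := by
  have hc : IsClosed {A : QuasiLocalAlgebra H | Commute (localObservable H ∅ T) A} :=
    isClosed_eq (by fun_prop) (by fun_prop)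
  refine hc.closure_subset_iff.mpr ?_ (dense_localObservable H A)
  refine Set.iUnion_subset fun X => ?_
  rintro _ ⟨S, rfl⟩
  exact localObservable_commute_of_disjoint (Finset.disjoint_empty_left X) T S

end Locality

/-! ### Summability of the interaction weights -/

section Decay

open scoped ENNReal

universe u v
variable {Λ : Type u} [MetricSpace Λ] {F : ℝ → ℝ}

theorem sum_le_toReal_of_tsum_le {α : Type*} {f : α → ℝ} (hf : ∀ i, 0 ≤ f i) {c : ℝ≥0∞}
    (hc : c ≠ ∞) (h : ∑' i, ENNReal.ofReal (f i) ≤ c) (s : Finset α) :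
    ∑ i ∈ s, f i ≤ c.toReal := by
  have h₁ := (ENNReal.sum_le_tsum s).trans h
  rw [← ENNReal.ofReal_sum_of_nonneg fun i _ => hf i] at h₁
  exact (ENNReal.ofReal_le_iff_le_toReal hc).mp h₁

theorem IsDecayFunction.dist_pos (hF : IsDecayFunction Λ F) (x y : Λ) : 0 < F (dist x y) :=
  hF.pos _ dist_nonneg

theorem IsDecayFunction.summable (hF : IsDecayFunction Λ F) (x : Λ) :
    Summable fun y => F (dist x y) :=
  summable_of_sum_le (fun y => (hF.dist_pos x y).le)
    (sum_le_toReal_of_tsum_le (fun y => (hF.dist_pos x y).le) hF.integrable.ne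
      (le_iSup (fun x : Λ => ∑' y : Λ, ENNReal.ofReal (F (dist x y))) x))

/-- A summable family has countable support, and here every member is strictly positive. -/
theorem IsDecayFunction.countable (hF : IsDecayFunction Λ F) : Countable Λ := by
  rcases isEmpty_or_nonempty Λ with h | ⟨⟨x⟩⟩
  · infer_instance
  · have := (hF.summable x).countable_support
    rw [show Function.support (fun y => F (dist x y)) = Set.univ from
      Set.eq_univ_of_forall fun y => (hF.dist_pos x y).ne'] at this
    exact Set.countable_univ_iff.mp this

theorem IsDecayFunction.exists_convolution_le (hF : IsDecayFunction Λ F) :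
    ∃ C : ℝ, 0 ≤ C ∧ ∀ (x y : Λ) (s : Finset Λ),
      ∑ z ∈ s, F (dist x z) * F (dist z y) ≤ C * F (dist x y) := by
  refine ⟨(⨆ (x : Λ) (y : Λ), ∑' z : Λ,
    ENNReal.ofReal (F (dist x z) * F (dist z y) / F (dist x y))).toReal,
    ENNReal.toReal_nonneg, fun x y s => ?_⟩
  have := sum_le_toReal_of_tsum_le (fun z => (div_pos (mul_pos (hF.dist_pos x z)
    (hF.dist_pos z y)) (hF.dist_pos x y)).le) hF.convolution.ne
    (le_iSup₂ (f := fun x y : Λ => ∑' z : Λ,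
      ENNReal.ofReal (F (dist x z) * F (dist z y) / F (dist x y))) x y) s
  rwa [← Finset.sum_div, div_le_iff₀ (hF.dist_pos x y)] at this

variable {H : Λ → Type v} [∀ x, NormedAddCommGroup (H x)]
  [∀ x, InnerProductSpace ℂ (H x)] [∀ x, FiniteDimensional ℂ (H x)]

/-- For `a ≥ 0` one has `F_a ≤ F`, so the exponential factor can be dropped: existence of the limit
needs only the decay of `F`. -/
theorem exists_sum_norm_term_le (hF : IsDecayFunction Λ F) {a : ℝ} (ha : 0 ≤ a)
    {Φ : Interaction H} (hΦ : Φ ∈ boundedInteractions H F a) :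
    ∃ N : ℝ, 0 ≤ N ∧ ∀ (x y : Λ) (s : Finset (Finset Λ)), (∀ X ∈ s, x ∈ X ∧ y ∈ X) →
      ∑ X ∈ s, ‖Φ.term X‖ ≤ N * F (dist x y) := by
  classical
  refine ⟨(interactionNorm F a Φ).toReal, ENNReal.toReal_nonneg, fun x y s hs => ?_⟩
  have hw : 0 < weightedDecay F a (dist x y) := mul_pos (Real.exp_pos _) (hF.dist_pos x y)
  have hle : weightedDecay F a (dist x y) ≤ F (dist x y) :=
    mul_le_of_le_one_left (hF.dist_pos x y).le (Real.exp_le_one_iff.mpr (by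
      have := mul_nonneg ha (dist_nonneg (x := x) (y := y)); linarith))
  have := sum_le_toReal_of_tsum_le
    (f := fun X : {X : Finset Λ // x ∈ X ∧ y ∈ X} => ‖Φ.term X‖ / weightedDecay F a (dist x y))
    (fun X => by positivity) (ne_of_lt hΦ)
    (le_iSup₂ (f := fun x y : Λ => ∑' X : {X : Finset Λ // x ∈ X ∧ y ∈ X},
      ENNReal.ofReal (‖Φ.term X‖ / weightedDecay F a (dist x y))) x y)
    (s.subtype fun X => x ∈ X ∧ y ∈ X)
  rw [Finset.sum_subtype_of_mem (fun X => ‖Φ.term X‖ / weightedDecay F a (dist x y)) hs,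
    ← Finset.sum_div, div_le_iff₀ hw] at this
  exact this.trans (by gcongr)

/-- The weight of the site `y` in the Lieb-Robinson bound for an observable supported in `X`. -/
def siteWeight (F : ℝ → ℝ) (X : Finset Λ) (y : Λ) : ℝ := ∑ x ∈ X, F (dist y x)

theorem siteWeight_nonneg (hF : IsDecayFunction Λ F) (X : Finset Λ) (y : Λ) :
    0 ≤ siteWeight F X y := Finset.sum_nonneg fun x _ => (hF.dist_pos y x).le

theorem summable_siteWeight (hF : IsDecayFunction Λ F) (X : Finset Λ) :
    Summable (siteWeight F X) :=
  summable_sum fun x _ => by simpa only [dist_comm] using hF.summable x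

/-- A common site contributes its diagonal term `F 0`; hence the factor `1 / F 0` in the estimates
below. -/
theorem le_sum_siteWeight (hF : IsDecayFunction Λ F) {X Y : Finset Λ} (h : ¬ Disjoint Y X) :
    F 0 ≤ ∑ y ∈ Y, siteWeight F X y := by
  obtain ⟨z, hY, hX⟩ := Finset.not_disjoint_iff.mp h
  calc F 0 = F (dist z z) := by rw [dist_self]
    _ ≤ siteWeight F X z :=
      Finset.single_le_sum (f := fun x => F (dist z x)) (fun x _ => (hF.dist_pos z x).le) hX
    _ ≤ _ := Finset.single_le_sum (f := siteWeight F X)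
      (fun y _ => siteWeight_nonneg hF X y) hY

/-- The weight of the interaction term `Φ(Y)` in the Lieb-Robinson bound for an observable
supported in `X`. -/
noncomputable def termWeight (F : ℝ → ℝ) (Φ : Interaction H) (X Y : Finset Λ) : ℝ :=
  ‖Φ.term Y‖ * ∑ y ∈ Y, siteWeight F X y

theorem termWeight_nonneg (hF : IsDecayFunction Λ F) (Φ : Interaction H) (X Y : Finset Λ) :
    0 ≤ termWeight F Φ X Y :=
  mul_nonneg (norm_nonneg _) (Finset.sum_nonneg fun y _ => siteWeight_nonneg hF X y)

/-- Exchanging the sums over `Y` and `y ∈ Y` leaves the sum over all `Y` containing both `z` and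
`y`, at most `N F(d(z,y))`. Convolving with `siteWeight` costs the factor `C`, so `K = N C` works
for every `X`. -/
theorem exists_sum_termWeight_le (hF : IsDecayFunction Λ F) {a : ℝ} (ha : 0 ≤ a)
    {Φ : Interaction H} (hΦ : Φ ∈ boundedInteractions H F a) :
    ∃ K : ℝ, 0 ≤ K ∧ ∀ (X : Finset Λ) (z : Λ) (s : Finset (Finset Λ)), (∀ Y ∈ s, z ∈ Y) →
      ∑ Y ∈ s, termWeight F Φ X Y ≤ K * siteWeight F X z := by
  classical
  obtain ⟨C, hC, hconv⟩ := hF.exists_convolution_le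
  obtain ⟨N, hN, hsum⟩ := exists_sum_norm_term_le hF ha hΦ
  refine ⟨N * C, mul_nonneg hN hC, fun X z s hs => ?_⟩
  set W : Finset Λ := s.biUnion id with hW
  calc ∑ Y ∈ s, termWeight F Φ X Y
      = ∑ Y ∈ s, ∑ y ∈ W with y ∈ Y, ‖Φ.term Y‖ * siteWeight F X y := by
        refine Finset.sum_congr rfl fun Y hY => ?_
        rw [termWeight, Finset.mul_sum, Finset.filter_mem_eq_inter,
          Finset.inter_eq_right.mpr (show Y ⊆ W from Finset.subset_biUnion_of_mem id hY)]
    _ = ∑ y ∈ W, ∑ Y ∈ s with y ∈ Y, ‖Φ.term Y‖ * siteWeight F X y := by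
        simp only [Finset.sum_filter]; exact Finset.sum_comm
    _ ≤ ∑ y ∈ W, N * F (dist z y) * siteWeight F X y := by
        refine Finset.sum_le_sum fun y _ => ?_
        rw [← Finset.sum_mul]
        refine mul_le_mul_of_nonneg_right (hsum z y _ fun Y hY => ?_) (siteWeight_nonneg hF X y)
        rw [Finset.mem_filter] at hY
        exact ⟨hs Y hY.1, hY.2⟩
    _ = N * ∑ x ∈ X, ∑ y ∈ W, F (dist z y) * F (dist y x) := by
        simp only [siteWeight, Finset.mul_sum]
        rw [Finset.sum_comm]
        simp only [mul_assoc]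
    _ ≤ N * ∑ x ∈ X, C * F (dist z x) := by
        gcongr with x; exact hconv z x W
    _ = N * C * siteWeight F X z := by rw [siteWeight, ← Finset.mul_sum, mul_assoc]

/-- Each `Y` is counted at least once among the sites of `Y ∩ Z`. Used twice: for the supersolution
condition and for the tail in Duhamel's estimate. -/
theorem sum_termWeight_le_sum_siteWeight (hF : IsDecayFunction Λ F) {Φ : Interaction H}
    {X : Finset Λ} {K : ℝ}
    (hK : ∀ (z : Λ) (s : Finset (Finset Λ)), (∀ Y ∈ s, z ∈ Y) →
      ∑ Y ∈ s, termWeight F Φ X Y ≤ K * siteWeight F X z)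
    (s : Finset (Finset Λ)) (Z : Finset Λ) (hs : ∀ Y ∈ s, ¬ Disjoint Y Z) :
    ∑ Y ∈ s, termWeight F Φ X Y ≤ K * ∑ z ∈ Z, siteWeight F X z := by
  classical
  calc _ ≤ ∑ Y ∈ s, ∑ z ∈ Z with z ∈ Y, termWeight F Φ X Y := by
        refine Finset.sum_le_sum fun Y hY => ?_
        obtain ⟨z, hzY, hzZ⟩ := Finset.not_disjoint_iff.mp (hs Y hY)
        exact Finset.single_le_sum (f := fun _ => termWeight F Φ X Y)
          (fun _ _ => termWeight_nonneg hF Φ X Y) (Finset.mem_filter.mpr ⟨hzZ, hzY⟩)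
    _ = ∑ z ∈ Z, ∑ Y ∈ s with z ∈ Y, termWeight F Φ X Y := by
        simp only [Finset.sum_filter]; exact Finset.sum_comm
    _ ≤ _ := by
        rw [Finset.mul_sum]
        exact Finset.sum_le_sum fun z _ => hK z _ fun Y hY => (Finset.mem_filter.mp hY).2

end Decay

/-! ### Limits of nets of inner evolutions -/

section LimitDynamics

open Filter Topology

variable {𝒜 : Type*} [CStarAlgebra 𝒜] {ι : Type*}

/-- Isometry allows the inner evolved observable to be replaced by its limit `B`; this gives the
group law. -/
theorem tendsto_evolution_evolution {p : Filter ι} {h : ι → 𝒜} (hh : ∀ i, IsSelfAdjoint (h i))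
    {s t : ℝ} {A B C : 𝒜} (hB : Tendsto (fun i => evolution (h i) t A) p (𝓝 B))
    (hC : Tendsto (fun i => evolution (h i) s B) p (𝓝 C)) :
    Tendsto (fun i => evolution (h i) (s + t) A) p (𝓝 C) := by
  have h₁ : Tendsto (fun i => evolution (h i) (s + t) A - evolution (h i) s B) p (𝓝 0) := by
    rw [tendsto_zero_iff_norm_tendsto_zero]
    simp_rw [← evolution_evolution, ← evolution_sub, norm_evolution (hh _)]
    exact tendsto_iff_norm_sub_tendsto_zero.mp hB
  simpa using h₁.add hC

/-- A net of evolutions that is uniformly Cauchy on bounded time intervals converges to a strongly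
continuous group of automorphisms. -/
theorem exists_isStronglyContinuousGroup_of_uniformCauchySeqOn {p : Filter ι} [NeBot p]
    {h : ι → 𝒜} (hh : ∀ i, IsSelfAdjoint (h i))
    (hcauchy : ∀ (A : 𝒜) (T : ℝ),
      UniformCauchySeqOn (fun i t => evolution (h i) t A) p (Set.Icc (-T) T)) :
    ∃ τ : ℝ → (𝒜 ≃⋆ₐ[ℂ] 𝒜), IsStronglyContinuousGroup τ ∧
      ∀ (A : 𝒜) (T : ℝ), TendstoUniformlyOn (fun i t => evolution (h i) t A)
        (fun t => τ t A) p (Set.Icc (-T) T) := by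
  have hex (t : ℝ) (A : 𝒜) : ∃ B, Tendsto (fun i => evolution (h i) t A) p (𝓝 B) :=
    CompleteSpace.complete
      ((hcauchy A |t|).cauchy_map ⟨neg_abs_le t, le_abs_self t⟩)
  choose σ hσ using hex
  have hadd (s t : ℝ) (A : 𝒜) : σ s (σ t A) = σ (s + t) A :=
    tendsto_nhds_unique (tendsto_evolution_evolution hh (hσ t A) (hσ s (σ t A))) (hσ (s + t) A)
  have hzero (A : 𝒜) : σ 0 A = A :=
    tendsto_nhds_unique (hσ 0 A) (by simpa only [evolution_zero] using tendsto_const_nhds)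
  let τ : ℝ → (𝒜 ≃⋆ₐ[ℂ] 𝒜) := fun t =>
    { toFun := σ t
      invFun := σ (-t)
      left_inv := fun A => by rw [hadd, neg_add_cancel, hzero]
      right_inv := fun A => by rw [hadd, add_neg_cancel, hzero]
      map_mul' := fun A B => tendsto_nhds_unique (hσ t (A * B))
        (by simpa only [evolution_mul] using (hσ t A).mul (hσ t B))
      map_add' := fun A B => tendsto_nhds_unique (hσ t (A + B))
        (by simpa only [evolution_add] using (hσ t A).add (hσ t B))
      map_star' := fun A => tendsto_nhds_unique (hσ t (star A))
        (by simpa only [evolution_star (hh _)] using (hσ t A).star)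
      map_smul' := fun c A => tendsto_nhds_unique (hσ t (c • A))
        (by simpa only [evolution_smul] using (hσ t A).const_smul c) }
  have hunif (A : 𝒜) (T : ℝ) : TendstoUniformlyOn (fun i t => evolution (h i) t A)
      (fun t => τ t A) p (Set.Icc (-T) T) :=
    (hcauchy A T).tendstoUniformlyOn_of_tendsto fun t _ => hσ t A
  refine ⟨τ, ⟨hzero, fun s t A => (hadd s t A).symm, fun A => ?_⟩, hunif⟩
  rw [continuous_iff_continuousAt]
  intro t
  have ht : Set.Icc (-(|t| + 1)) (|t| + 1) ∈ 𝓝 t :=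
    Icc_mem_nhds (by linarith [neg_abs_le t]) (by linarith [le_abs_self t])
  exact ((hunif A _).continuousOn
    (Frequently.of_forall fun i => (continuous_evolution (h i) A).continuousOn)).continuousAt ht

end LimitDynamics

/-! ### The Cauchy property of the finite-volume dynamics -/

section InfiniteVolume

open Filter Topology

universe u v
variable {Λ : Type u} {H : Λ → Type v} [∀ x, NormedAddCommGroup (H x)]
  [∀ x, InnerProductSpace ℂ (H x)] [∀ x, FiniteDimensional ℂ (H x)] [∀ x, Nontrivial (H x)]

theorem isSelfAdjoint_localObservable_term (Φ : Interaction H) (X : Finset Λ) :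
    IsSelfAdjoint (localObservable H X (Φ.term X)) :=
  (Φ.isSelfAdjoint X).map (localObservable H X)

theorem isSelfAdjoint_localHamiltonian (Φ : Interaction H) (V : Finset Λ) :
    IsSelfAdjoint (localHamiltonian Φ V) := by
  simp only [localHamiltonian, IsSelfAdjoint, star_sum,
    (isSelfAdjoint_localObservable_term Φ _).star_eq]

theorem exists_isExhausting (Λ : Type*) [Countable Λ] : ∃ V : ℕ → Finset Λ, IsExhausting V := by
  classical
  obtain ⟨f, hf⟩ := exists_injective_nat Λ
  have hfin (n : ℕ) : {x | f x ≤ n}.Finite := (Set.finite_Iic n).preimage hf.injOn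
  refine ⟨fun n => (hfin n).toFinset, fun m n hmn x hx => ?_, fun x => ⟨f x, by simp⟩⟩
  simp only [Set.Finite.mem_toFinset, Set.mem_ofPred_eq] at hx ⊢
  exact hx.trans hmn

theorem IsExhausting.tendsto_atTop {V : ℕ → Finset Λ} (hV : IsExhausting V) :
    Tendsto V atTop atTop :=
  tendsto_atTop_finset_of_monotone hV.monotone hV.exhausts

variable [MetricSpace Λ] {F : ℝ → ℝ}

theorem norm_bracket_localObservable_le (hF : IsDecayFunction Λ F) (Φ : Interaction H)
    {X : Finset Λ} (T : LocalAlgebra H X) (Y : Finset Λ) :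
    ‖bracket (localObservable H Y (Φ.term Y)) (localObservable H X T)‖ ≤
      2 * ‖T‖ / F 0 * termWeight F Φ X Y := by
  have h0 := hF.pos 0 le_rfl
  by_cases h : Disjoint Y X
  · rw [bracket_eq_zero (localObservable_commute_of_disjoint h _ _), norm_zero]
    have := termWeight_nonneg hF Φ X Y
    positivity
  · have hw := le_sum_siteWeight hF h
    calc _ ≤ 2 * ‖Φ.term Y‖ * ‖T‖ := by
          simpa only [norm_localObservable] using norm_bracket_le_two_mul
            (localObservable H Y (Φ.term Y)) (localObservable H X T)
      _ = 2 * ‖T‖ / F 0 * (‖Φ.term Y‖ * F 0) := by field_simp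
      _ ≤ _ := by rw [termWeight]; gcongr

/-- For nonempty `X` all site weights are positive, so the weight vanishes only if `Φ(Y) = 0` or `Y
= ∅`. -/
theorem localObservable_term_commute_of_termWeight_eq_zero (hF : IsDecayFunction Λ F)
    {Φ : Interaction H} {X Y : Finset Λ} (hX : X.Nonempty) (h : termWeight F Φ X Y = 0)
    (A : QuasiLocalAlgebra H) : Commute (localObservable H Y (Φ.term Y)) A := by
  rcases mul_eq_zero.mp h with h | h
  · rw [norm_eq_zero.mp h, map_zero]; exact Commute.zero_left A
  · rcases Y.eq_empty_or_nonempty with rfl | hY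
    · exact localObservable_empty_commute _ A
    · exact absurd h (Finset.sum_pos (fun y _ =>
        Finset.sum_pos (fun x _ => hF.dist_pos y x) hX) hY).ne'

/-- The Lieb-Robinson bound for the terms of an interaction. -/
theorem norm_bracket_evolution_localObservable_le (hF : IsDecayFunction Λ F)
    {Φ : Interaction H} {X : Finset Λ} (hX : X.Nonempty) {K : ℝ} (hK₀ : 0 ≤ K)
    (hK : ∀ (z : Λ) (s : Finset (Finset Λ)), (∀ Y ∈ s, z ∈ Y) →
      ∑ Y ∈ s, termWeight F Φ X Y ≤ K * siteWeight F X z)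
    (T : LocalAlgebra H X) (V Y : Finset Λ) (t : ℝ) :
    ‖bracket (localObservable H Y (Φ.term Y))
      (evolution (localHamiltonian Φ V) t (localObservable H X T))‖ ≤
      2 * ‖T‖ / F 0 * termWeight F Φ X Y * Real.exp (2 * K * |t|) := by
  classical
  refine norm_bracket_evolution_le (a := fun Y => localObservable H Y (Φ.term Y))
    (isSelfAdjoint_localObservable_term Φ) V.powerset (fun Y Z => ¬ Disjoint Y Z)
    (fun Y Z h => localObservable_commute_of_disjoint (not_not.mp h) _ _)
    (termWeight_nonneg hF Φ X)
    (fun Y h => localObservable_term_commute_of_termWeight_eq_zero hF hX h) (by positivity)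
    (fun Y => ?_) (norm_bracket_localObservable_le hF Φ T) t Y
  rw [norm_localObservable]
  calc _ ≤ 2 * ‖Φ.term Y‖ * (K * ∑ y ∈ Y, siteWeight F X y) := by
        gcongr
        exact sum_termWeight_le_sum_siteWeight hF hK _ Y fun Z hZ h =>
          (Finset.mem_filter.mp hZ).2 h.symm
    _ = _ := by rw [termWeight]; ring

theorem norm_evolution_localHamiltonian_sub_le (hF : IsDecayFunction Λ F)
    {Φ : Interaction H} {X : Finset Λ} (hX : X.Nonempty) {K : ℝ} (hK₀ : 0 ≤ K)
    (hK : ∀ (z : Λ) (s : Finset (Finset Λ)), (∀ Y ∈ s, z ∈ Y) →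
      ∑ Y ∈ s, termWeight F Φ X Y ≤ K * siteWeight F X z)
    (T : LocalAlgebra H X) {V W D : Finset Λ} (hVW : V ⊆ W) (hD : ∀ z ∈ W, z ∉ V → z ∈ D) (t : ℝ) :
    ‖evolution (localHamiltonian Φ W) t (localObservable H X T) -
      evolution (localHamiltonian Φ V) t (localObservable H X T)‖ ≤
      2 * ‖T‖ / F 0 * Real.exp (2 * K * |t|) * (K * ∑ z ∈ D, siteWeight F X z) * |t| := by
  classical
  have h0 := hF.pos 0 le_rfl
  refine norm_evolution_sub_evolution_le (isSelfAdjoint_localHamiltonian Φ W) _ fun s hs => ?_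
  have e : localHamiltonian Φ W - localHamiltonian Φ V =
      ∑ Y ∈ W.powerset \ V.powerset, localObservable H Y (Φ.term Y) := by
    rw [localHamiltonian, localHamiltonian,
      ← Finset.sum_sdiff (Finset.powerset_mono.mpr hVW), add_sub_cancel_right]
  rw [e, bracket_sum_left]
  calc _ ≤ ∑ Y ∈ W.powerset \ V.powerset,
        2 * ‖T‖ / F 0 * termWeight F Φ X Y * Real.exp (2 * K * |s|) :=
        norm_sum_le_of_le _ fun Y _ =>
          norm_bracket_evolution_localObservable_le hF hX hK₀ hK T V Y s
    _ = 2 * ‖T‖ / F 0 * Real.exp (2 * K * |s|) *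
        ∑ Y ∈ W.powerset \ V.powerset, termWeight F Φ X Y := by
        rw [Finset.mul_sum]; exact Finset.sum_congr rfl fun Y _ => by ring
    _ ≤ 2 * ‖T‖ / F 0 * Real.exp (2 * K * |t|) * (K * ∑ z ∈ D, siteWeight F X z) := by
        gcongr
        · exact Finset.sum_nonneg fun Y _ => termWeight_nonneg hF Φ X Y
        · refine sum_termWeight_le_sum_siteWeight hF hK _ D fun Y hY => ?_
          simp only [Finset.mem_sdiff, Finset.mem_powerset] at hY
          obtain ⟨z, hzY, hzV⟩ := Finset.not_subset.mp hY.2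
          exact Finset.not_disjoint_iff.mpr ⟨z, hzY, hD z (hY.1 hzY) hzV⟩

theorem exists_norm_evolution_localHamiltonian_sub_lt (hF : IsDecayFunction Λ F) {a : ℝ}
    (ha : 0 ≤ a) {Φ : Interaction H} (hΦ : Φ ∈ boundedInteractions H F a) {X : Finset Λ}
    (S : LocalAlgebra H X) (T : ℝ) {ε : ℝ} (hε : 0 < ε) :
    ∃ V : Finset Λ, ∀ W, V ⊆ W → ∀ t ∈ Set.Icc (-T) T,
      ‖evolution (localHamiltonian Φ W) t (localObservable H X S) -
        evolution (localHamiltonian Φ V) t (localObservable H X S)‖ < ε := by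
  classical
  -- For empty `X` all weights vanish and the Lieb-Robinson bound is unavailable, but the observable
  -- is central and does not evolve.
  rcases X.eq_empty_or_nonempty with rfl | hX
  · refine ⟨∅, fun W _ t _ => ?_⟩
    simpa only [evolution_of_commute (localObservable_empty_commute S _), sub_self,
      norm_zero] using hε
  obtain ⟨K, hK₀, hK⟩ := exists_sum_termWeight_le hF ha hΦ
  have h0 := hF.pos 0 le_rfl
  set c : ℝ := 2 * ‖S‖ / F 0 * Real.exp (2 * K * |T|) * K * |T| with hc
  have hc₀ : 0 ≤ c := by positivity
  -- The tail outside `V` must beat the time-dependent prefactor `c`; `c + 1` guards against `c =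
  -- 0`.
  obtain ⟨V, hV⟩ := summable_iff_vanishing_norm.mp (summable_siteWeight hF X) (ε / (c + 1))
    (by positivity)
  refine ⟨V, fun W hVW t ht => ?_⟩
  have htT : |t| ≤ |T| := (abs_le.mpr ht).trans (le_abs_self T)
  have hσ : 0 ≤ ∑ z ∈ W \ V, siteWeight F X z :=
    Finset.sum_nonneg fun z _ => siteWeight_nonneg hF X z
  have hlt := hV (W \ V) Finset.sdiff_disjoint
  rw [Real.norm_of_nonneg hσ, lt_div_iff₀ (by positivity)] at hlt
  calc _ ≤ 2 * ‖S‖ / F 0 * Real.exp (2 * K * |t|) *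
        (K * ∑ z ∈ W \ V, siteWeight F X z) * |t| :=
        norm_evolution_localHamiltonian_sub_le hF hX hK₀ (hK X) S hVW
          (fun z h h' => Finset.mem_sdiff.mpr ⟨h, h'⟩) t
    _ ≤ 2 * ‖S‖ / F 0 * Real.exp (2 * K * |T|) *
        (K * ∑ z ∈ W \ V, siteWeight F X z) * |T| := by gcongr
    _ = (∑ z ∈ W \ V, siteWeight F X z) * c := by rw [hc]; ring
    _ ≤ (∑ z ∈ W \ V, siteWeight F X z) * (c + 1) := by gcongr; linarith
    _ < ε := hlt

theorem uniformCauchySeqOn_evolution_localHamiltonian (hF : IsDecayFunction Λ F) {a : ℝ}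
    (ha : 0 ≤ a) {Φ : Interaction H} (hΦ : Φ ∈ boundedInteractions H F a)
    (A : QuasiLocalAlgebra H) (T : ℝ) :
    UniformCauchySeqOn (fun V t => evolution (localHamiltonian Φ V) t A) atTop
      (Set.Icc (-T) T) := by
  classical
  rw [Metric.uniformCauchySeqOn_iff]
  intro ε hε
  obtain ⟨B, hB, hAB⟩ := (dense_localObservable H).exists_dist_lt A (ε := ε / 4) (by positivity)
  obtain ⟨X, S, rfl⟩ := Set.mem_iUnion.mp hB
  obtain ⟨V, hV⟩ := exists_norm_evolution_localHamiltonian_sub_lt hF ha hΦ S T (ε := ε / 4)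
    (by positivity)
  have hd (W : Finset Λ) (t : ℝ) : dist (evolution (localHamiltonian Φ W) t A)
      (evolution (localHamiltonian Φ W) t (localObservable H X S)) < ε / 4 := by
    rwa [dist_eq_norm, ← evolution_sub, norm_evolution (isSelfAdjoint_localHamiltonian Φ W),
      ← dist_eq_norm]
  refine ⟨V, fun W hW W' hW' t ht => ?_⟩
  have h₁ := hV W hW t ht
  have h₂ := hV W' hW' t ht
  rw [← dist_eq_norm] at h₁ h₂
  have h₃ := hd W t
  have h₄ := hd W' t
  rw [dist_comm] at h₂ h₄
  linarith [dist_triangle4 (evolution (localHamiltonian Φ W) t A)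
    (evolution (localHamiltonian Φ W) t (localObservable H X S))
    (evolution (localHamiltonian Φ V) t (localObservable H X S))
    (evolution (localHamiltonian Φ W') t A),
    dist_triangle (evolution (localHamiltonian Φ V) t (localObservable H X S))
    (evolution (localHamiltonian Φ W') t (localObservable H X S))
    (evolution (localHamiltonian Φ W') t A)]

end InfiniteVolume

end QuantumSpin

/-! ### Existence and uniqueness of the infinite-volume dynamics -/

theorem theorem2p2 {Λ : Type*} [MetricSpace Λ]
    (H : Λ → Type*) [∀ x, NormedAddCommGroup (H x)] [∀ x, InnerProductSpace ℂ (H x)]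
    [∀ x, FiniteDimensional ℂ (H x)] [∀ x, Nontrivial (H x)]
    (F : ℝ → ℝ) (hF : QuantumSpin.IsDecayFunction Λ F) (a : ℝ) (ha : 0 ≤ a)
    (Φ : QuantumSpin.Interaction H) (hΦ : Φ ∈ QuantumSpin.boundedInteractions H F a) :
    ∃! τ : ℝ → (QuantumSpin.QuasiLocalAlgebra H ≃⋆ₐ[ℂ] QuantumSpin.QuasiLocalAlgebra H),
      QuantumSpin.IsStronglyContinuousGroup τ ∧
      ∀ V : ℕ → Finset Λ, QuantumSpin.IsExhausting V →
        ∀ (A : QuantumSpin.QuasiLocalAlgebra H) (K : Set ℝ), IsCompact K →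
          TendstoUniformlyOn (fun n t => QuantumSpin.finiteVolumeDynamics Φ (V n) t A)
            (fun t => τ t A) Filter.atTop K := by
  classical
  obtain ⟨τ, hτ, hlim⟩ :=
    QuantumSpin.exists_isStronglyContinuousGroup_of_uniformCauchySeqOn
      (QuantumSpin.isSelfAdjoint_localHamiltonian Φ)
      (QuantumSpin.uniformCauchySeqOn_evolution_localHamiltonian hF ha hΦ)
  have hconv : ∀ V : ℕ → Finset Λ, QuantumSpin.IsExhausting V →
      ∀ (A : QuantumSpin.QuasiLocalAlgebra H) (K : Set ℝ), IsCompact K →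
        TendstoUniformlyOn (fun n t => QuantumSpin.finiteVolumeDynamics Φ (V n) t A)
          (fun t => τ t A) Filter.atTop K := by
    intro V hV A K hK
    obtain ⟨T, hT⟩ := hK.isBounded.subset_closedBall 0
    rw [Real.closedBall_eq_Icc, zero_sub, zero_add] at hT
    -- `finiteVolumeDynamics` is by definition `evolution` of `localHamiltonian`, and an exhausting
    -- sequence is cofinal among the finite sets.
    exact fun u hu => hV.tendsto_atTop.eventually (((hlim A T).mono hT) u hu)
  refine ⟨τ, ⟨hτ, hconv⟩, fun τ' hτ' => ?_⟩
  -- Without an exhausting sequence the convergence condition would be vacuous and could not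
  -- determine `τ'`.
  have := hF.countable
  obtain ⟨V, hV⟩ := QuantumSpin.exists_isExhausting Λ
  funext t
  refine StarAlgEquiv.ext fun A => ?_
  exact tendsto_nhds_unique
    ((hτ'.2 V hV A {t} isCompact_singleton).tendsto_at (Set.mem_singleton t))
    ((hconv V hV A {t} isCompact_singleton).tendsto_at (Set.mem_singleton t))
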